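/- All graphs are finite and simple. The size of a graph is its number of edges; a graph is isolate-free if it has no isolated vertex; $\rho(G)$ denotes the largest eigenvalue of the adjacency matrix of $G$. A chorded cycle in $G$ is a cycle $C$ of $G$ for which some edge of $G$ joins two vertices of $C$ and is not an edge of $C$. Write $\cup$ for disjoint union, $kH$ for the disjoint union of $k$ copies of $H$, and $G\vee H$ for the join (the disjoint union of $G$ and $H$ together with all edges between them). For $4\le m\le 8$ put $t=\lfloor m/3\rfloor$, let $\theta(m)$ be the largest root of $x^3-x^2+(t-m)x+m-3t=0$, and let $G_m=K_1\vee(tK_2\cup(m-3t)K_1)$ (so $G_6=K_1\vee 2K_2$). Theorem. Let $G$ be an isolate-free graph of size $m\ge 4$. (i) If $m\le 8$ and $\rho(G)\ge\theta(m)$, then $G$ contains a chorded cycle unless $G\cong G_m$. (ii) If $m\ge 9$ and $\rho(G)\ge\sqrt m$, then $G$ contains a chorded cycle unless $m=9$ and $G$ is isomorphic to one of $K_1\vee 3K_2$, $K_1\vee(2K_2\cup 3K_1)$, $K_1\vee(K_2\cup 6K_1)$, $K_{1,9}$, or $m\ge 10$ and $G\cong K_{1,m}$, or $m\ge 10$ is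 even and $G\cong K_{2,m/2}$. Equivalently, if $G$ contains no chorded cycle, then $\rho(G)\le\theta(m)$ when $m\le 8$, with equality if and only if $G\cong G_m$, and $\rho(G)\le\sqrt m$ when $m\ge 9$, with equality if and only if $G$ is one of the exceptional graphs listed in (ii) for that $m$. Moreover, none of these exceptional graphs (neither $G_m$ for $m \le 8$ nor those in (ii)) contains a chorded cycle. -/

import Mathlib

/-!
Let `r = ρ(G)` with `r > 2` and `r² ≥ m`. Replacing a Perron vector by its absolute value and
rescaling gives `x ≤ A x / r` with maximum `x u = 1`. Take the Perron vector of a triangle star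
centred at `u` and extend it by `1` to the vertices at distance two attached to triangles through
`u`. Without chorded cycles, the excess `c = A y - r y` of the resulting vector `y` is nonnegative
away from `u`, and symmetry of `A` gives `∑ c = ⟨y, A x - r x⟩ + ⟨c, 1 - x⟩ ≥ 0`. Counting the
edges from `u`, where the `t` triangles at `u` are edge-disjoint, turns `∑ c ≥ 0` into `(r - 1)
(r² - m) ≤ (3 - r) t`. The right side is positive for `r < 3` and negative for `r > 3`, which is
why the answer changes at `m = 9`; with `t = ⌊m / 3⌋`, equality is the equation defining `θ(m)`.
In the case of equality no vertex is attached and all vertices at distance two have the same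
neighbours as `u`, so that `G` is a triangle star if `t > 0` and complete bipartite if `t = 0`.
-/

namespace ChordedCycle

/-- `G` contains a chorded cycle: a cycle together with an edge of `G` that joins two of its
vertices and is not an edge of the cycle. -/
def HasChordedCycle {V : Type*} (G : SimpleGraph V) : Prop :=
  ∃ (v : V) (c : G.Walk v v) (e : Sym2 V), c.IsCycle ∧ c.IsChord e

/-- The largest eigenvalue of the adjacency matrix
(see `isGreatest_rho`: for a nonempty graph it is attained). -/
noncomputable def rho {V : Type*} [Fintype V] [DecidableEq V] (G : SimpleGraph V)
    [DecidableRel G.Adj] : ℝ :=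
  sSup {x : ℝ | Module.End.HasEigenvalue (Matrix.toLin' (G.adjMatrix ℝ)) x}

theorem isGreatest_rho {V : Type*} [Fintype V] [DecidableEq V] [Nonempty V] (G : SimpleGraph V)
    [DecidableRel G.Adj] :
    IsGreatest {x : ℝ | Module.End.HasEigenvalue (Matrix.toLin' (G.adjMatrix ℝ)) x} (rho G) := by
  have hfin : {x : ℝ | Module.End.HasEigenvalue (Matrix.toLin' (G.adjMatrix ℝ)) x}.Finite :=
    Module.End.finite_hasEigenvalue _
  have hne : {x : ℝ | Module.End.HasEigenvalue (Matrix.toLin' (G.adjMatrix ℝ)) x}.Nonempty := by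
    have hH : (G.adjMatrix ℝ).IsHermitian := by
      rw [Matrix.IsHermitian, Matrix.conjTranspose_eq_transpose_of_trivial]
      exact G.isSymm_adjMatrix
    refine ⟨hH.eigenvalues (Classical.arbitrary V), ?_⟩
    rw [Set.mem_ofPred_eq, Module.End.hasEigenvalue_iff_mem_spectrum, Matrix.spectrum_toLin']
    exact hH.eigenvalues_mem_spectrum_real _
  exact ⟨hne.csSup_mem hfin, fun x hx => le_csSup hfin.bddAbove hx⟩

/-- The largest real root of `x³ - x² + (t - m) x + m - 3 t`, where `t = ⌊m / 3⌋`
(see `isGreatest_theta`: it is attained). -/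
noncomputable def theta (m : ℕ) : ℝ :=
  sSup {x : ℝ | x ^ 3 - x ^ 2 + (((m / 3 : ℕ) : ℝ) - m) * x + m - 3 * ((m / 3 : ℕ) : ℝ) = 0}

theorem isGreatest_theta (m : ℕ) :
    IsGreatest {x : ℝ | x ^ 3 - x ^ 2 + (((m / 3 : ℕ) : ℝ) - m) * x + m
      - 3 * ((m / 3 : ℕ) : ℝ) = 0} (theta m) := by
  have ht : (3 : ℝ) * ((m / 3 : ℕ) : ℝ) ≤ m := by exact_mod_cast Nat.mul_div_le m 3
  have ht0 : (0 : ℝ) ≤ ((m / 3 : ℕ) : ℝ) := Nat.cast_nonneg _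
  unfold theta
  generalize ((m / 3 : ℕ) : ℝ) = t at *
  generalize (m : ℝ) = a at *
  have hcont : Continuous fun x : ℝ => x ^ 3 - x ^ 2 + (t - a) * x + a - 3 * t := by fun_prop
  have hcl : IsClosed {x : ℝ | x ^ 3 - x ^ 2 + (t - a) * x + a - 3 * t = 0} :=
    isClosed_eq hcont continuous_const
  have hbdd : BddAbove {x : ℝ | x ^ 3 - x ^ 2 + (t - a) * x + a - 3 * t = 0} := by
    refine ⟨a + 1, fun x hx => ?_⟩
    by_contra! h
    have hx' : x ^ 3 - x ^ 2 + (t - a) * x + a - 3 * t = 0 := hx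
    nlinarith [mul_pos (show 0 < x - 1 - a by linarith) (show 0 < x by linarith),
      mul_pos (mul_pos (show 0 < x - 1 - a by linarith) (show 0 < x by linarith))
        (show 0 < x by linarith), mul_nonneg ht0 (show 0 ≤ x by linarith),
      mul_nonneg (show 0 ≤ a by linarith) (sq_nonneg (x - 1))]
  have hne : {x : ℝ | x ^ 3 - x ^ 2 + (t - a) * x + a - 3 * t = 0}.Nonempty := by
    have h1 : (fun x : ℝ => x ^ 3 - x ^ 2 + (t - a) * x + a - 3 * t) (-(a + 1)) ≤ 0 := by
      have : 0 ≤ a := by linarith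
      simp only
      nlinarith [mul_nonneg ht0 this, mul_nonneg this this, mul_nonneg (mul_nonneg this this) this]
    have h2 : 0 ≤ (fun x : ℝ => x ^ 3 - x ^ 2 + (t - a) * x + a - 3 * t) (a + 1) := by
      have : 0 ≤ a := by linarith
      simp only
      nlinarith [mul_nonneg ht0 this, mul_nonneg this this, mul_nonneg (mul_nonneg this this) this]
    obtain ⟨x, -, hx⟩ := intermediate_value_Icc (show -(a + 1) ≤ a + 1 by linarith)
      hcont.continuousOn ⟨h1, h2⟩
    exact ⟨x, hx⟩
  exact ⟨hcl.csSup_mem hne hbdd, fun x hx => le_csSup hbdd hx⟩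

/-- The join `G ∨ H`: the disjoint union of `G` and `H` with all edges between them added. -/
def join {V W : Type*} (G : SimpleGraph V) (H : SimpleGraph W) : SimpleGraph (V ⊕ W) :=
  (G ⊕g H) ⊔ completeBipartiteGraph V W

/-- The disjoint union `k H` of `k` copies of `H`. -/
def copies {W : Type*} (k : ℕ) (H : SimpleGraph W) : SimpleGraph (Fin k × W) where
  Adj x y := x.1 = y.1 ∧ H.Adj x.2 y.2
  symm := ⟨fun _ _ h => ⟨h.1.symm, h.2.symm⟩⟩
  loopless := ⟨fun _ h => H.loopless.irrefl _ h.2⟩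

/-- The complete graph on `n` vertices. -/
abbrev K (n : ℕ) : SimpleGraph (Fin n) := ⊤

/-- The graph `K₁ ∨ (t K₂ ∪ s K₁)`; for `s = 0` this is `K₁ ∨ t K₂`. -/
abbrev triangleStar (t s : ℕ) :
    SimpleGraph (Fin 1 ⊕ ((Fin t × Fin 2) ⊕ (Fin s × Fin 1))) :=
  join (K 1) (copies t (K 2) ⊕g copies s (K 1))

/-- `G ≅ G_m`, where `G_m = K₁ ∨ (t K₂ ∪ (m - 3t) K₁)` and `t = ⌊m / 3⌋`. -/
def IsExtremalSmall {V : Type*} (m : ℕ) (G : SimpleGraph V) : Prop :=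
  Nonempty (G ≃g triangleStar (m / 3) (m - 3 * (m / 3)))

/-- The extremal graphs of size `m ≥ 9`. -/
def IsExtremalLarge {V : Type*} (m : ℕ) (G : SimpleGraph V) : Prop :=
  (m = 9 ∧
    (Nonempty (G ≃g triangleStar 3 0) ∨
      Nonempty (G ≃g triangleStar 2 3) ∨
      Nonempty (G ≃g triangleStar 1 6) ∨
      Nonempty (G ≃g completeBipartiteGraph (Fin 1) (Fin 9)))) ∨
  (10 ≤ m ∧
    (Nonempty (G ≃g completeBipartiteGraph (Fin 1) (Fin m)) ∨
      (Even m ∧ Nonempty (G ≃g completeBipartiteGraph (Fin 2) (Fin (m / 2))))))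

end ChordedCycle

namespace ChordedCycle

open Finset SimpleGraph

section Cycles

variable {V W : Type*} {G : SimpleGraph V} {H : SimpleGraph W}

theorem HasChordedCycle.map (f : G ↪g H) (h : HasChordedCycle G) : HasChordedCycle H := by
  obtain ⟨v, c, e, hc, he⟩ := h
  induction e with | h p q =>
  obtain ⟨hpq, hne, hp, hq⟩ := Walk.isChord_sym2Mk.1 he
  refine ⟨f v, c.map f.toHom, s(f p, f q), hc.map f.injective,
    Walk.isChord_sym2Mk.2 ⟨f.map_adj_iff.2 hpq, ?_, ?_, ?_⟩⟩
  · rw [Walk.edges_map]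
    intro hmem
    obtain ⟨e', he', heq⟩ := List.mem_map.1 hmem
    have heq' : e' = s(p, q) := Sym2.map.injective f.injective heq
    exact hne (heq' ▸ he')
  · exact Walk.support_map f.toHom c ▸ List.mem_map_of_mem hp
  · exact Walk.support_map f.toHom c ▸ List.mem_map_of_mem hq

theorem hasChordedCycle_of_four_cycle {u a b c : V} (hua : G.Adj u a) (hab : G.Adj a b)
    (hbc : G.Adj b c) (hcu : G.Adj c u) (hub : G.Adj u b) (hac : a ≠ c) :
    HasChordedCycle G := by
  refine ⟨u, .cons hua (.cons hab (.cons hbc (.cons hcu .nil))), s(u, b), ?_, ?_⟩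
  · simp only [Walk.cons_isCycle_iff, Walk.cons_isPath_iff, Walk.isPath_iff_nil, Walk.nil_nil,
      Walk.support_nil, List.mem_cons, List.not_mem_nil, or_false, true_and, Walk.support_cons,
      not_or, Walk.edges_cons, Walk.edges_nil, Sym2.eq, Sym2.rel_iff', Prod.mk.injEq,
      Prod.swap_prod_mk, and_true, not_and]
    grind [hua.ne, hab.ne, hbc.ne, hcu.ne, hub.ne]
  · simp only [Walk.isChord_sym2Mk, Walk.edges_cons, Walk.edges_nil, List.mem_cons, Sym2.eq,
      Sym2.rel_iff', Prod.mk.injEq, true_and, Prod.swap_prod_mk, and_true, List.not_mem_nil,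
      or_false, not_or, not_and, Walk.support_cons, Walk.support_nil, or_true, or_self, true_or,
      and_self]
    grind [hua.ne, hab.ne, hbc.ne, hcu.ne, hub.ne]

theorem hasChordedCycle_of_five_cycle {u b a w c : V} (hub : G.Adj u b) (hba : G.Adj b a)
    (haw : G.Adj a w) (hwc : G.Adj w c) (hcu : G.Adj c u) (hua : G.Adj u a)
    (huw : u ≠ w) (hbw : b ≠ w) (hbc : b ≠ c) (hac : a ≠ c) :
    HasChordedCycle G := by
  refine ⟨u, .cons hub (.cons hba (.cons haw (.cons hwc (.cons hcu .nil)))), s(u, a), ?_, ?_⟩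
  · simp only [Walk.cons_isCycle_iff, Walk.cons_isPath_iff, Walk.isPath_iff_nil, Walk.nil_nil,
      Walk.support_nil, List.mem_cons, List.not_mem_nil, or_false, true_and, Walk.support_cons,
      not_or, Walk.edges_cons, Walk.edges_nil, Sym2.eq, Sym2.rel_iff', Prod.mk.injEq,
      Prod.swap_prod_mk, and_true, not_and]
    grind [hub.ne, hba.ne, haw.ne, hwc.ne, hcu.ne, hua.ne]
  · simp only [Walk.isChord_sym2Mk, Walk.edges_cons, Walk.edges_nil, List.mem_cons, Sym2.eq,
      Sym2.rel_iff', Prod.mk.injEq, true_and, Prod.swap_prod_mk, and_true, List.not_mem_nil,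
      or_false, not_or, not_and, Walk.support_cons, Walk.support_nil, or_true, or_self, true_or,
      and_self]
    grind [hub.ne, hba.ne, haw.ne, hwc.ne, hcu.ne, hua.ne]

theorem eq_of_adj_of_adj_of_adj (hG : ¬ HasChordedCycle G) {u a b c : V} (hua : G.Adj u a)
    (hub : G.Adj u b) (huc : G.Adj u c) (hab : G.Adj a b) (hac : G.Adj a c) : b = c := by
  by_contra hbc
  exact hG (hasChordedCycle_of_four_cycle hub hab.symm hac huc.symm hua hbc)

theorem card_le_two_or_card_le_two (hG : ¬ HasChordedCycle G) {S R : Finset V}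
    (h : ∀ v ∈ S, ∀ w ∈ R, G.Adj v w) : #S ≤ 2 ∨ #R ≤ 2 := by
  by_contra! hcard
  obtain ⟨a, b, c, ha, hb, hc, hab, hac, hbc⟩ := two_lt_card_iff.1 hcard.1
  obtain ⟨x, y, z, hx, hy, hz, hxy, hxz, hyz⟩ := two_lt_card_iff.1 hcard.2
  have hne : ∀ v ∈ S, ∀ w ∈ R, v ≠ w := fun v hv w hw => (h v hv w hw).ne
  refine hG ⟨a, .cons (h a ha x hx) (.cons (h b hb x hx).symm (.cons (h b hb y hy)
    (.cons (h c hc y hy).symm (.cons (h c hc z hz) (.cons (h a ha z hz).symm .nil))))),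
    s(a, y), ?_, ?_⟩
  · simp only [Walk.cons_isCycle_iff, Walk.cons_isPath_iff, Walk.isPath_iff_nil, Walk.nil_nil,
      Walk.support_nil, List.mem_cons, List.not_mem_nil, or_false, true_and, Walk.support_cons,
      not_or, Walk.edges_cons, Walk.edges_nil, Sym2.eq, Sym2.rel_iff', Prod.mk.injEq,
      Prod.swap_prod_mk, and_true, not_and]
    grind
  · simp only [Walk.isChord_sym2Mk, h a ha y hy, Walk.edges_cons, Walk.edges_nil, List.mem_cons,
      Sym2.eq, Sym2.rel_iff', Prod.mk.injEq, true_and, Prod.swap_prod_mk, and_true,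
      List.not_mem_nil, or_false, not_or, not_and, Walk.support_cons, Walk.support_nil, or_true,
      or_self, true_or, and_self]
    grind

theorem two_lt_encard_neighborSet_of_isChord {v p q : V} {c : G.Walk v v} (hc : c.IsCycle)
    (h : c.IsChord s(p, q)) : 2 < (G.neighborSet p).encard := by
  obtain ⟨hpq, hne, hp, -⟩ := Walk.isChord_sym2Mk.1 h
  have hq : q ∉ c.toSubgraph.neighborSet p := fun hq => hne ((Walk.mem_edges_toSubgraph c).1 hq)
  have hsub : insert q (c.toSubgraph.neighborSet p) ⊆ G.neighborSet p :=
    Set.insert_subset hpq (c.toSubgraph.neighborSet_subset p)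
  have hcard : (c.toSubgraph.neighborSet p).encard = 2 := by
    obtain ⟨a, b, hab, hs⟩ := Set.ncard_eq_two.1 (hc.ncard_neighborSet_toSubgraph_eq_two hp)
    rw [hs, Set.encard_pair hab]
  refine lt_of_lt_of_le ?_ (Set.encard_le_encard hsub)
  rw [Set.encard_insert_of_notMem hq, hcard]
  norm_num

theorem HasChordedCycle.exists_adj (h : HasChordedCycle G) :
    ∃ p q, G.Adj p q ∧ 2 < (G.neighborSet p).encard ∧ 2 < (G.neighborSet q).encard := by
  obtain ⟨v, c, e, hc, he⟩ := h
  induction e with | h p q =>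
  exact ⟨p, q, (Walk.isChord_sym2Mk.1 he).1, two_lt_encard_neighborSet_of_isChord hc he,
    two_lt_encard_neighborSet_of_isChord hc (Sym2.eq_swap ▸ he)⟩

end Cycles

section ExtremalGraphs

theorem triangleStar_adj_inl {t s : ℕ} (z : Fin 1) (x) :
    (triangleStar t s).Adj (Sum.inl z) x ↔ x ≠ Sum.inl 0 := by
  rcases x with x | x <;> simp [triangleStar, join, Subsingleton.elim _ (0 : Fin 1)]

theorem triangleStar_adj_pair {t s : ℕ} (i : Fin t) (j : Fin 2) (x) :
    (triangleStar t s).Adj (Sum.inr (Sum.inl (i, j))) x ↔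
      x = Sum.inl 0 ∨ x = Sum.inr (Sum.inl (i, j + 1)) := by
  rcases x with x | ⟨i', j'⟩ | x
  · simp [triangleStar, join, Subsingleton.elim _ (0 : Fin 1)]
  · fin_cases j <;> fin_cases j' <;> simp [triangleStar, join, copies, eq_comm]
  · simp [triangleStar, join]

theorem triangleStar_adj_leaf {t s : ℕ} (p : Fin s × Fin 1) (x) :
    (triangleStar t s).Adj (Sum.inr (Sum.inr p)) x ↔ x = Sum.inl 0 := by
  rcases x with x | x | x <;> simp [triangleStar, join, copies, Subsingleton.elim _ (0 : Fin 1)]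

theorem not_hasChordedCycle_triangleStar (t s : ℕ) : ¬ HasChordedCycle (triangleStar t s) := by
  have eq_center : ∀ p, 2 < ((triangleStar t s).neighborSet p).encard → p = Sum.inl 0 := by
    rintro (z | ⟨i, j⟩ | q) hp
    · rw [Subsingleton.elim z 0]
    · refine absurd hp (not_lt.2 (le_trans (Set.encard_le_encard fun x hx => ?_)
        (Set.encard_pair (x := Sum.inl 0) (y := Sum.inr (Sum.inl (i, j + 1))) Sum.inl_ne_inr).le))
      exact (triangleStar_adj_pair i j x).1 hx
    · refine absurd hp (not_lt.2 (le_trans (Set.encard_le_encard fun x hx => ?_)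
        ((Set.encard_singleton (Sum.inl 0)).trans_le one_le_two)))
      exact (triangleStar_adj_leaf q x).1 hx
  intro h
  obtain ⟨p, q, hpq, hp, hq⟩ := h.exists_adj
  exact hpq.ne ((eq_center p hp).trans (eq_center q hq).symm)

theorem not_hasChordedCycle_completeBipartiteGraph {V W : Type*} (hV : ENat.card V ≤ 2) :
    ¬ HasChordedCycle (completeBipartiteGraph V W) := by
  have isLeft : ∀ p, 2 < ((completeBipartiteGraph V W).neighborSet p).encard → p.isLeft := by
    rintro (p | p) hp
    · rfl
    · refine absurd hp (not_lt.2 (le_trans (Set.encard_le_encard (t := Set.range Sum.inl) ?_) ?_))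
      · rintro (x | x) hx
        · exact ⟨x, rfl⟩
        · simp at hx
      · rwa [← Set.image_univ, Sum.inl_injective.encard_image, Set.encard_univ]
  intro h
  obtain ⟨p, q, hpq, hp, hq⟩ := h.exists_adj
  have hp' := isLeft p hp
  have hq' := isLeft q hq
  simp [← Sum.not_isLeft, hp', hq'] at hpq

theorem IsExtremalSmall.not_hasChordedCycle {V : Type*} {G : SimpleGraph V} {m : ℕ}
    (h : IsExtremalSmall m G) : ¬ HasChordedCycle G := by
  obtain ⟨e⟩ := h
  exact mt (HasChordedCycle.map e.toEmbedding) (not_hasChordedCycle_triangleStar _ _)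

theorem IsExtremalLarge.not_hasChordedCycle {V : Type*} {G : SimpleGraph V} {m : ℕ}
    (h : IsExtremalLarge m G) : ¬ HasChordedCycle G := by
  have star {t s} (e : G ≃g triangleStar t s) : ¬ HasChordedCycle G :=
    mt (HasChordedCycle.map e.toEmbedding) (not_hasChordedCycle_triangleStar t s)
  have bipartite {a b} (ha : a ≤ 2) (e : G ≃g completeBipartiteGraph (Fin a) (Fin b)) :
      ¬ HasChordedCycle G :=
    mt (HasChordedCycle.map e.toEmbedding)
      (not_hasChordedCycle_completeBipartiteGraph (by simpa using mod_cast ha))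
  rcases h with ⟨-, ⟨⟨e⟩⟩ | ⟨⟨e⟩⟩ | ⟨⟨e⟩⟩ | ⟨⟨e⟩⟩⟩ | ⟨-, ⟨⟨e⟩⟩ | ⟨-, ⟨e⟩⟩⟩
  exacts [star e, star e, star e, bipartite one_le_two e, bipartite one_le_two e,
    bipartite le_rfl e]

end ExtremalGraphs

section DegreeIn

variable {V : Type*} (G : SimpleGraph V) [DecidableRel G.Adj]

/-- The number of neighbours of `v` in `S`. -/
def degreeIn (S : Finset V) (v : V) : ℕ := #{w ∈ S | G.Adj v w}

variable {G}

theorem degreeIn_eq_sum {S : Finset V} {v : V} :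
    degreeIn G S v = ∑ w ∈ S, if G.Adj v w then 1 else 0 :=
  card_filter _ _

theorem degreeIn_eq_zero_iff {S : Finset V} {v : V} :
    degreeIn G S v = 0 ↔ ∀ w ∈ S, ¬ G.Adj v w := by
  rw [degreeIn, card_eq_zero, filter_eq_empty_iff]

theorem degreeIn_eq_one {S : Finset V} {v w : V} (hw : w ∈ S) (hvw : G.Adj v w)
    (huniq : ∀ b ∈ S, G.Adj v b → b = w) : degreeIn G S v = 1 := by
  refine card_eq_one.2 ⟨w, eq_singleton_iff_unique_mem.2 ⟨mem_filter.2 ⟨hw, hvw⟩, ?_⟩⟩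
  exact fun b hb => huniq b (mem_filter.1 hb).1 (mem_filter.1 hb).2

theorem degreeIn_mono {S R : Finset V} (h : S ⊆ R) (v : V) : degreeIn G S v ≤ degreeIn G R v :=
  card_le_card (filter_subset_filter _ h)

theorem sum_degreeIn_comm (S R : Finset V) :
    ∑ v ∈ S, degreeIn G R v = ∑ w ∈ R, degreeIn G S w := by
  simp only [degreeIn_eq_sum]
  rw [sum_comm]
  simp only [G.adj_comm]

theorem two_mul_sum_degreeIn_le {A W : Finset V} (h : A ⊆ W) :
    2 * ∑ w ∈ A, degreeIn G W w ≤ ∑ w ∈ W, degreeIn G W w + ∑ w ∈ A, degreeIn G A w := by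
  classical
  have houtside : ∑ w ∈ W \ A, degreeIn G A w ≤ ∑ w ∈ W \ A, degreeIn G W w :=
    sum_le_sum fun w _ => degreeIn_mono h w
  have hW := sum_sdiff (f := degreeIn G W) h
  have hA := sum_sdiff (f := degreeIn G A) h
  have hcomm := sum_degreeIn_comm (G := G) A W
  lia

variable [Fintype V]

theorem degreeIn_univ (v : V) : degreeIn G univ v = G.degree v := by
  rw [degreeIn, ← G.neighborFinset_eq_filter, card_neighborFinset_eq_degree]

variable [DecidableEq V]

theorem sum_neighborFinset_ite (S : Finset V) (v : V) :
    ∑ w ∈ G.neighborFinset v, (if w ∈ S then (1 : ℝ) else 0) = degreeIn G S v := by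
  rw [sum_boole, degreeIn]
  congr 2
  ext w
  simp only [mem_filter, mem_neighborFinset, and_comm]

theorem sum_univ_eq_add_sum_neighborFinset {M : Type*} [AddCommMonoid M] (f : V → M) (u : V) :
    ∑ v, f v = f u + ∑ v ∈ G.neighborFinset u, f v + ∑ v ∈ Gᶜ.neighborFinset u, f v := by
  have hu : u ∉ G.neighborFinset u := by simp
  have hcompl : Gᶜ.neighborFinset u = (insert u (G.neighborFinset u))ᶜ := by
    rw [neighborFinset_compl, insert_eq, union_comm, compl_union, sdiff_eq_inter_compl]
  rw [← sum_insert hu, hcompl, sum_add_sum_compl]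

theorem degree_eq_degreeIn_neighborFinset_add (u v : V) :
    G.degree v = (if G.Adj v u then 1 else 0) + degreeIn G (G.neighborFinset u) v +
      degreeIn G (Gᶜ.neighborFinset u) v := by
  simp only [← degreeIn_univ, degreeIn_eq_sum]
  exact sum_univ_eq_add_sum_neighborFinset _ u

theorem two_mul_card_edgeFinset (u : V) :
    2 * #G.edgeFinset = 2 * G.degree u + ∑ v ∈ G.neighborFinset u, degreeIn G (G.neighborFinset u) v
      + 2 * ∑ w ∈ Gᶜ.neighborFinset u, degreeIn G (G.neighborFinset u) w
      + ∑ w ∈ Gᶜ.neighborFinset u, degreeIn G (Gᶜ.neighborFinset u) w := by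
  have hnear : ∀ v ∈ G.neighborFinset u, G.degree v = 1 + degreeIn G (G.neighborFinset u) v +
      degreeIn G (Gᶜ.neighborFinset u) v := fun v hv => by
    rw [degree_eq_degreeIn_neighborFinset_add u, if_pos ((G.mem_neighborFinset u v).1 hv).symm]
  have hfar : ∀ w ∈ Gᶜ.neighborFinset u, G.degree w = degreeIn G (G.neighborFinset u) w +
      degreeIn G (Gᶜ.neighborFinset u) w := fun w hw => by
    rw [mem_neighborFinset, compl_adj] at hw
    rw [degree_eq_degreeIn_neighborFinset_add u, if_neg (mt Adj.symm hw.2), zero_add]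
  rw [← G.sum_degrees_eq_twice_card_edges, sum_univ_eq_add_sum_neighborFinset (G := G) _ u,
    sum_congr rfl hnear, sum_congr rfl hfar]
  simp only [sum_add_distrib, sum_const, card_neighborFinset_eq_degree, smul_eq_mul, mul_one]
  rw [sum_degreeIn_comm (G.neighborFinset u) (Gᶜ.neighborFinset u)]
  ring

end DegreeIn

section LocalStructure

variable {V : Type*} [Fintype V] (G : SimpleGraph V) [DecidableRel G.Adj]

/-- The vertices other than `u` on the triangles through `u`. -/
def triangleNeighbors (u : V) : Finset V :=
  {a ∈ G.neighborFinset u | ∃ b, G.Adj u b ∧ G.Adj a b}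

/-- The vertices at distance two from `u` with a neighbour on a triangle through `u`. -/
def attachedVertices [DecidableEq V] (u : V) : Finset V :=
  {w ∈ Gᶜ.neighborFinset u | ∃ a ∈ triangleNeighbors G u, G.Adj w a}

variable {G} {u : V}

theorem mem_triangleNeighbors {a : V} :
    a ∈ triangleNeighbors G u ↔ G.Adj u a ∧ ∃ b, G.Adj u b ∧ G.Adj a b := by
  rw [triangleNeighbors, mem_filter, mem_neighborFinset]

theorem triangleNeighbors_subset : triangleNeighbors G u ⊆ G.neighborFinset u :=
  filter_subset _ _

theorem degreeIn_neighborFinset_self : degreeIn G (G.neighborFinset u) u = G.degree u := by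
  rw [degreeIn, filter_true_of_mem fun w => (G.mem_neighborFinset u w).1,
    card_neighborFinset_eq_degree]

theorem two_le_card_triangleNeighbors (h : (triangleNeighbors G u).Nonempty) :
    2 ≤ #(triangleNeighbors G u) := by
  obtain ⟨a, ha⟩ := h
  obtain ⟨hua, b, hub, hab⟩ := mem_triangleNeighbors.1 ha
  exact one_lt_card.2 ⟨a, ha, b, mem_triangleNeighbors.2 ⟨hub, a, hua, hab.symm⟩, hab.ne⟩

theorem degreeIn_triangleNeighbors_self :
    degreeIn G (triangleNeighbors G u) u = #(triangleNeighbors G u) := by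
  rw [degreeIn, filter_true_of_mem fun w hw => (mem_triangleNeighbors.1 hw).1]

theorem eq_of_mem_triangleNeighbors (hG : ¬ HasChordedCycle G) {a c w : V}
    (ha : a ∈ triangleNeighbors G u) (huw : Gᶜ.Adj u w) (hwa : G.Adj w a)
    (huc : G.Adj u c) (hwc : G.Adj w c) : c = a := by
  obtain ⟨hua, b, hub, hab⟩ := mem_triangleNeighbors.1 ha
  obtain ⟨hne, hnadj⟩ := (G.compl_adj u w).1 huw
  have hbw : b ≠ w := fun h => hnadj (h ▸ hub)
  by_contra hca
  by_cases hcb : c = b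
  · subst hcb
    exact hG (hasChordedCycle_of_four_cycle hwa.symm hwc hub.symm hua hab hne.symm)
  · exact hG (hasChordedCycle_of_five_cycle hub hab.symm hwa.symm hwc huc.symm hua hne hbw
      (Ne.symm hcb) (Ne.symm hca))

theorem degreeIn_neighborFinset_of_adj [DecidableEq V] (hG : ¬ HasChordedCycle G) {a : V}
    (hua : G.Adj u a) :
    degreeIn G (G.neighborFinset u) a = if a ∈ triangleNeighbors G u then 1 else 0 := by
  split_ifs with ha
  · obtain ⟨-, b, hub, hab⟩ := mem_triangleNeighbors.1 ha
    refine degreeIn_eq_one ((G.mem_neighborFinset u b).2 hub) hab fun c hc hac => ?_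
    exact eq_of_adj_of_adj_of_adj hG hua ((G.mem_neighborFinset u c).1 hc) hub hac hab
  · refine degreeIn_eq_zero_iff.2 fun b hb hab => ha ?_
    exact mem_triangleNeighbors.2 ⟨hua, b, (G.mem_neighborFinset u b).1 hb, hab⟩

theorem sum_degreeIn_neighborFinset (hG : ¬ HasChordedCycle G) (u : V) :
    ∑ a ∈ G.neighborFinset u, degreeIn G (G.neighborFinset u) a = #(triangleNeighbors G u) := by
  classical
  rw [sum_congr rfl fun a ha => degreeIn_neighborFinset_of_adj hG ((G.mem_neighborFinset u a).1 ha),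
    sum_boole, filter_mem_eq_inter, inter_eq_right.2 triangleNeighbors_subset, Nat.cast_id]

variable [DecidableEq V]

theorem mem_attachedVertices {w : V} :
    w ∈ attachedVertices G u ↔ Gᶜ.Adj u w ∧ ∃ a ∈ triangleNeighbors G u, G.Adj w a := by
  rw [attachedVertices, mem_filter, mem_neighborFinset]

theorem attachedVertices_subset : attachedVertices G u ⊆ Gᶜ.neighborFinset u :=
  filter_subset _ _

theorem degreeIn_attachedVertices_self : degreeIn G (attachedVertices G u) u = 0 :=
  degreeIn_eq_zero_iff.2 fun _ hw =>
    ((G.compl_adj _ _).1 (mem_attachedVertices.1 hw).1).2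

theorem degreeIn_triangleNeighbors_of_adj (hG : ¬ HasChordedCycle G) {a : V} (hua : G.Adj u a) :
    degreeIn G (triangleNeighbors G u) a = if a ∈ triangleNeighbors G u then 1 else 0 := by
  rw [← degreeIn_neighborFinset_of_adj hG hua, degreeIn, degreeIn]
  congr 1
  ext b
  simp only [mem_filter, mem_triangleNeighbors, mem_neighborFinset]
  exact ⟨fun h => ⟨h.1.1, h.2⟩, fun h => ⟨⟨h.1, a, hua, h.2.symm⟩, h.2⟩⟩

theorem degreeIn_triangleNeighbors_of_compl_adj (hG : ¬ HasChordedCycle G) {w : V}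
    (huw : Gᶜ.Adj u w) :
    degreeIn G (triangleNeighbors G u) w = if w ∈ attachedVertices G u then 1 else 0 := by
  split_ifs with hA
  · obtain ⟨-, a, ha, hwa⟩ := mem_attachedVertices.1 hA
    exact degreeIn_eq_one ha hwa fun c hc hwc =>
      eq_of_mem_triangleNeighbors hG ha huw hwa (mem_triangleNeighbors.1 hc).1 hwc
  · exact degreeIn_eq_zero_iff.2 fun a ha hwa => hA (mem_attachedVertices.2 ⟨huw, a, ha, hwa⟩)

theorem one_le_degreeIn_neighborFinset {w : V} (hw : w ∈ attachedVertices G u) :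
    1 ≤ degreeIn G (G.neighborFinset u) w := by
  obtain ⟨-, a, ha, hwa⟩ := mem_attachedVertices.1 hw
  exact card_pos.2 ⟨a, mem_filter.2 ⟨triangleNeighbors_subset ha, hwa⟩⟩

theorem degree_of_mem_attachedVertices (hG : ¬ HasChordedCycle G) {w : V}
    (hw : w ∈ attachedVertices G u) :
    G.degree w = 1 + degreeIn G (Gᶜ.neighborFinset u) w := by
  obtain ⟨huw, a, ha, hwa⟩ := mem_attachedVertices.1 hw
  have hone : degreeIn G (G.neighborFinset u) w = 1 :=
    degreeIn_eq_one (triangleNeighbors_subset ha) hwa fun c hc hwc =>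
      eq_of_mem_triangleNeighbors hG ha huw hwa ((G.mem_neighborFinset u c).1 hc) hwc
  rw [degree_eq_degreeIn_neighborFinset_add u, if_neg (mt Adj.symm ((G.compl_adj u w).1 huw).2),
    hone, zero_add]

theorem card_attachedVertices_le :
    #(attachedVertices G u) ≤ ∑ w ∈ Gᶜ.neighborFinset u, degreeIn G (G.neighborFinset u) w := by
  calc #(attachedVertices G u)
      ≤ ∑ w ∈ attachedVertices G u, degreeIn G (G.neighborFinset u) w := by
        simpa using card_nsmul_le_sum _ _ 1 fun w => one_le_degreeIn_neighborFinset (G := G)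
    _ ≤ _ := sum_le_sum_of_subset attachedVertices_subset

end LocalStructure

section Subeigenvector

variable {V : Type*} [Fintype V] (G : SimpleGraph V) [DecidableRel G.Adj]

/-- The entry at `v` of `A y - r y`, where `A` is the adjacency matrix of `G`. -/
def excess (r : ℝ) (y : V → ℝ) (v : V) : ℝ :=
  ∑ w ∈ G.neighborFinset v, y w - r * y v

/-- A nonnegative vector `x` with `r x ≤ A x`, scaled so that its maximum is `1` and is attained
at `u`. -/
structure IsPeakedSubeigenvector (r : ℝ) (u : V) (x : V → ℝ) : Prop where
  nonneg : ∀ v, 0 ≤ x v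
  le_one : ∀ v, x v ≤ 1
  apply_peak : x u = 1
  excess_nonneg : ∀ v, 0 ≤ excess G r x v

variable {G}

theorem hasEigenvalue_adjMatrix_iff [DecidableEq V] {r : ℝ} :
    Module.End.HasEigenvalue (Matrix.toLin' (G.adjMatrix ℝ)) r ↔
      ∃ y : V → ℝ, y ≠ 0 ∧ ∀ v, ∑ w ∈ G.neighborFinset v, y w = r * y v := by
  refine ⟨fun h => ?_, fun ⟨y, hy0, hy⟩ => ?_⟩
  · obtain ⟨y, hy⟩ := h.exists_hasEigenvector
    refine ⟨y, hy.2, fun v => ?_⟩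
    simpa using congrFun hy.apply_eq_smul v
  · refine Module.End.hasEigenvalue_of_hasEigenvector (x := y)
      ⟨Module.End.mem_eigenspace_iff.2 (funext fun v => ?_), hy0⟩
    simpa using hy v

theorem exists_isPeakedSubeigenvector [DecidableEq V] {r : ℝ} (hr : 0 ≤ r)
    (h : Module.End.HasEigenvalue (Matrix.toLin' (G.adjMatrix ℝ)) r) :
    ∃ u x, IsPeakedSubeigenvector G r u x := by
  obtain ⟨y, hy0, hy⟩ := hasEigenvalue_adjMatrix_iff.1 h
  obtain ⟨v, hv⟩ := Function.ne_iff.1 hy0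
  obtain ⟨u, -, hu⟩ := exists_max_image univ (fun v => |y v|) ⟨v, mem_univ v⟩
  have hpos : 0 < |y u| := (abs_pos.2 hv).trans_le (hu v (mem_univ v))
  refine ⟨u, fun v => |y v| / |y u|, fun v => by positivity,
    fun v => div_le_one_of_le₀ (hu v (mem_univ v)) hpos.le, div_self hpos.ne', fun v => ?_⟩
  have hv : r * |y v| ≤ ∑ w ∈ G.neighborFinset v, |y w| := by
    calc r * |y v| = |∑ w ∈ G.neighborFinset v, y w| := by rw [hy, abs_mul, abs_of_nonneg hr]
      _ ≤ _ := abs_sum_le_sum_abs _ _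
  rw [excess, ← sum_div, ← mul_div_assoc, ← sub_div]
  exact div_nonneg (sub_nonneg.2 hv) hpos.le

theorem sum_mul_excess_comm (r : ℝ) (x y : V → ℝ) :
    ∑ v, x v * excess G r y v = ∑ v, y v * excess G r x v := by
  have hsymm := Matrix.dotProduct_mulVec x (G.adjMatrix ℝ) y
  simp only [dotProduct, adjMatrix_mulVec_apply, adjMatrix_vecMul_apply] at hsymm
  simp only [excess, mul_sub, sum_sub_distrib, hsymm]
  congr 1 <;> exact sum_congr rfl fun v _ => by ring

/-- This is the symmetry of the adjacency matrix, arranged so that for a peaked subeigenvector `x`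
both summands have the sign of `y` and of its excess. -/
theorem sum_excess_eq (r : ℝ) (x y : V → ℝ) :
    ∑ v, excess G r y v = ∑ v, y v * excess G r x v + ∑ v, excess G r y v * (1 - x v) := by
  rw [← sum_mul_excess_comm, ← sum_add_distrib]
  exact sum_congr rfl fun v _ => by ring

end Subeigenvector

section TestVector

variable {V : Type*} [Fintype V] [DecidableEq V] (G : SimpleGraph V) [DecidableRel G.Adj]

/-- A candidate for an eigenvector, compared with a peaked subeigenvector at `u`. For
`K₁ ∨ (t K₂ ∪ s K₁)` with centre `u` and largest eigenvalue `r > 1` it is a Perron vector; in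
general this vector is extended by `1` to the attached vertices and by `0` to the remaining ones. -/
def testVector (r : ℝ) (u v : V) : ℝ :=
  r * (r - 1) * (if v = u then 1 else 0) + (r - 1) * (if v ∈ G.neighborFinset u then 1 else 0) +
    (if v ∈ triangleNeighbors G u then 1 else 0) + (if v ∈ attachedVertices G u then 1 else 0)

variable {G} {r : ℝ} {u : V}

theorem testVector_nonneg (hr : 1 ≤ r) (v : V) : 0 ≤ testVector G r u v := by
  have : 0 ≤ r - 1 := sub_nonneg.2 hr
  unfold testVector
  positivity

theorem testVector_self : testVector G r u u = r * (r - 1) := by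
  simp [testVector, mem_triangleNeighbors, mem_attachedVertices]

theorem testVector_of_adj {v : V} (h : G.Adj u v) :
    testVector G r u v = (r - 1) + if v ∈ triangleNeighbors G u then 1 else 0 := by
  simp [testVector, mem_attachedVertices, h, h.ne']

theorem testVector_of_compl_adj {v : V} (h : Gᶜ.Adj u v) :
    testVector G r u v = if v ∈ attachedVertices G u then 1 else 0 := by
  have h' := (G.compl_adj u v).1 h
  simp [testVector, mem_triangleNeighbors, h'.1.symm, h'.2]

theorem sum_neighborFinset_testVector (v : V) :
    ∑ w ∈ G.neighborFinset v, testVector G r u w = r * (r - 1) * (if G.Adj v u then 1 else 0) +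
      (r - 1) * degreeIn G (G.neighborFinset u) v + degreeIn G (triangleNeighbors G u) v +
      degreeIn G (attachedVertices G u) v := by
  simp only [testVector, sum_add_distrib, ← mul_sum, sum_neighborFinset_ite, sum_ite_eq']
  simp only [mem_neighborFinset]

theorem excess_testVector_self :
    excess G r (testVector G r u) u =
      (r - 1) * G.degree u + #(triangleNeighbors G u) - r ^ 2 * (r - 1) := by
  rw [excess, sum_neighborFinset_testVector, testVector_self, degreeIn_neighborFinset_self,
    degreeIn_triangleNeighbors_self, degreeIn_attachedVertices_self, if_neg (G.irrefl)]
  push_cast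
  ring

theorem excess_testVector_of_adj (hG : ¬ HasChordedCycle G) {v : V} (huv : G.Adj u v) :
    excess G r (testVector G r u) v = degreeIn G (attachedVertices G u) v := by
  rw [excess, sum_neighborFinset_testVector, testVector_of_adj huv, if_pos huv.symm,
    degreeIn_neighborFinset_of_adj hG huv, degreeIn_triangleNeighbors_of_adj hG huv]
  push_cast
  ring

theorem excess_testVector_of_compl_adj (hG : ¬ HasChordedCycle G) {v : V} (huv : Gᶜ.Adj u v) :
    excess G r (testVector G r u) v = (r - 1) * (degreeIn G (G.neighborFinset u) v -
      if v ∈ attachedVertices G u then 1 else 0) + degreeIn G (attachedVertices G u) v := by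
  rw [excess, sum_neighborFinset_testVector, testVector_of_compl_adj huv,
    if_neg (mt Adj.symm ((G.compl_adj u v).1 huv).2),
    degreeIn_triangleNeighbors_of_compl_adj hG huv]
  push_cast
  ring

theorem excess_testVector_nonneg (hG : ¬ HasChordedCycle G) (hr : 1 ≤ r) {v : V} (hv : v ≠ u) :
    0 ≤ excess G r (testVector G r u) v := by
  by_cases huv : G.Adj u v
  · rw [excess_testVector_of_adj hG huv]
    positivity
  · rw [excess_testVector_of_compl_adj hG ((G.compl_adj u v).2 ⟨hv.symm, huv⟩)]
    have hone : (if v ∈ attachedVertices G u then (1 : ℝ) else 0) ≤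
        degreeIn G (G.neighborFinset u) v := by
      split_ifs with hA
      · exact_mod_cast one_le_degreeIn_neighborFinset hA
      · positivity
    have := mul_nonneg (sub_nonneg.2 hr) (sub_nonneg.2 hone)
    positivity

theorem sum_excess_testVector (hG : ¬ HasChordedCycle G) :
    ∑ v, excess G r (testVector G r u) v = (r - 1) * G.degree u + #(triangleNeighbors G u) -
      r ^ 2 * (r - 1) + ∑ w ∈ attachedVertices G u, (G.degree w : ℝ) +
      (r - 1) * (∑ w ∈ Gᶜ.neighborFinset u, (degreeIn G (G.neighborFinset u) w : ℝ) -
        #(attachedVertices G u)) := by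
  have hattached : ∑ v, (degreeIn G (attachedVertices G u) v : ℝ) =
      ∑ w ∈ attachedVertices G u, (G.degree w : ℝ) := by
    simp only [← degreeIn_univ]
    exact_mod_cast sum_degreeIn_comm univ (attachedVertices G u)
  have hind : ∑ w ∈ Gᶜ.neighborFinset u, (if w ∈ attachedVertices G u then (1 : ℝ) else 0) =
      #(attachedVertices G u) := by
    rw [sum_boole, filter_mem_eq_inter, inter_eq_right.2 attachedVertices_subset]
  rw [sum_univ_eq_add_sum_neighborFinset (G := G) _ u, degreeIn_attachedVertices_self] at hattached
  rw [sum_univ_eq_add_sum_neighborFinset (G := G) _ u, excess_testVector_self,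
    sum_congr rfl fun v hv => excess_testVector_of_adj hG ((G.mem_neighborFinset u v).1 hv),
    sum_congr rfl fun v hv => excess_testVector_of_compl_adj hG ((Gᶜ.mem_neighborFinset u v).1 hv),
    sum_add_distrib, ← mul_sum, sum_sub_distrib, hind, ← hattached]
  push_cast
  ring

theorem sum_excess_testVector_add (hG : ¬ HasChordedCycle G) :
    ∑ v, excess G r (testVector G r u) v + (r - 1) * (r ^ 2 - #G.edgeFinset) +
      ((r - 1) * (#(attachedVertices G u) +
        (∑ w ∈ Gᶜ.neighborFinset u, degreeIn G (Gᶜ.neighborFinset u) w : ℕ) / 2) -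
        ∑ w ∈ attachedVertices G u, (G.degree w : ℝ)) =
    (3 - r) * (#(triangleNeighbors G u) / 2) := by
  have hsize := two_mul_card_edgeFinset (G := G) u
  rw [sum_degreeIn_neighborFinset hG] at hsize
  rw [sum_excess_testVector hG]
  have hsize' : (2 * #G.edgeFinset : ℝ) = 2 * G.degree u + #(triangleNeighbors G u) +
      2 * ∑ w ∈ Gᶜ.neighborFinset u, (degreeIn G (G.neighborFinset u) w : ℝ) +
      ∑ w ∈ Gᶜ.neighborFinset u, (degreeIn G (Gᶜ.neighborFinset u) w : ℝ) := by
    exact_mod_cast hsize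
  push_cast
  linear_combination (-(r - 1) / 2) * hsize'

end TestVector

section SpectralEstimate

variable {V : Type*} [Fintype V] [DecidableEq V] {G : SimpleGraph V} [DecidableRel G.Adj]
  {r : ℝ} {u : V} {x : V → ℝ}

theorem add_lt_mul_add_half {r k E e : ℝ} (hr : 2 < r) (hk : 2 ≤ k) (hE : 0 ≤ E) (he : e ≤ E)
    (h : k + E / 2 + 3 ≤ r ^ 2) : k + e < (r - 1) * (k + E / 2) := by
  set n := k + E / 2 with hn
  have hn2 : 2 ≤ n := hk.trans (le_add_of_nonneg_right (div_nonneg hE zero_le_two))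
  suffices 3 * n - 2 < r * n by linarith
  refine lt_of_pow_lt_pow_left₀ 2 (by positivity) ?_
  calc (3 * n - 2) ^ 2 < n ^ 2 * (n + 3) := by
        linarith [pow_nonneg (sub_nonneg.2 hn2) 3]
    _ ≤ n ^ 2 * r ^ 2 := by gcongr
    _ = (r * n) ^ 2 := by ring

theorem card_attachedVertices_add_le (hG : ¬ HasChordedCycle G)
    (hA : (attachedVertices G u).Nonempty) :
    2 * #(attachedVertices G u) + ∑ w ∈ Gᶜ.neighborFinset u, degreeIn G (Gᶜ.neighborFinset u) w + 6
      ≤ 2 * #G.edgeFinset := by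
  obtain ⟨w, hw⟩ := hA
  obtain ⟨-, a, ha, -⟩ := mem_attachedVertices.1 hw
  have htwo := two_le_card_triangleNeighbors ⟨a, ha⟩
  have hdeg := card_le_card (triangleNeighbors_subset (G := G) (u := u))
  rw [card_neighborFinset_eq_degree] at hdeg
  have hattached := card_attachedVertices_le (G := G) (u := u)
  rw [two_mul_card_edgeFinset u, sum_degreeIn_neighborFinset hG]
  lia

theorem sum_degree_attachedVertices_lt (hG : ¬ HasChordedCycle G) (hr : 2 < r)
    (hm : #G.edgeFinset ≤ r ^ 2) (hA : (attachedVertices G u).Nonempty) :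
    ∑ w ∈ attachedVertices G u, (G.degree w : ℝ) < (r - 1) * (#(attachedVertices G u) +
      (∑ w ∈ Gᶜ.neighborFinset u, degreeIn G (Gᶜ.neighborFinset u) w : ℕ) / 2) := by
  set A := attachedVertices G u
  set W := Gᶜ.neighborFinset u
  have hAW : A ⊆ W := attachedVertices_subset
  have hsize : (#A : ℝ) + (∑ w ∈ W, degreeIn G W w : ℕ) / 2 + 3 ≤ r ^ 2 := by
    have : (2 * #A + (∑ w ∈ W, degreeIn G W w : ℕ) + 6 : ℝ) ≤ 2 * #G.edgeFinset := by
      exact_mod_cast card_attachedVertices_add_le hG hA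
    linarith
  have hdeg : ∑ w ∈ A, (G.degree w : ℝ) = #A + (∑ w ∈ A, degreeIn G W w : ℕ) := by
    rw [sum_congr rfl fun w hw => congrArg Nat.cast (degree_of_mem_attachedVertices hG hw)]
    push_cast
    rw [sum_add_distrib, sum_const, nsmul_one]
  rw [hdeg]
  obtain hone | htwo := (Nat.succ_le_of_lt hA.card_pos).eq_or_lt
  · obtain ⟨w, hw⟩ := card_eq_one.1 hone.symm
    have hself : ∑ w ∈ A, degreeIn G A w = 0 := by
      rw [hw, sum_singleton, degreeIn_eq_zero_iff]
      simp
    have hhalf : (2 * (∑ w ∈ A, degreeIn G W w : ℕ) : ℝ) ≤ (∑ w ∈ W, degreeIn G W w : ℕ) := by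
      exact_mod_cast hself ▸ two_mul_sum_degreeIn_le (G := G) hAW
    have hE : (0 : ℝ) ≤ (∑ w ∈ W, degreeIn G W w : ℕ) := Nat.cast_nonneg _
    rw [← hone, Nat.cast_one]
    linarith [mul_nonneg (sub_nonneg.2 hr.le) hE]
  · refine add_lt_mul_add_half hr (by exact_mod_cast htwo) (by positivity) ?_ hsize
    exact_mod_cast sum_le_sum_of_subset hAW

theorem sum_degree_attachedVertices_le (hG : ¬ HasChordedCycle G) (hr : 2 < r)
    (hm : #G.edgeFinset ≤ r ^ 2) :
    ∑ w ∈ attachedVertices G u, (G.degree w : ℝ) ≤ (r - 1) * (#(attachedVertices G u) +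
      (∑ w ∈ Gᶜ.neighborFinset u, degreeIn G (Gᶜ.neighborFinset u) w : ℕ) / 2) := by
  obtain hA | hA := (attachedVertices G u).eq_empty_or_nonempty
  · have : 0 ≤ r - 1 := by linarith
    rw [hA, sum_empty]
    positivity
  · exact (sum_degree_attachedVertices_lt hG hr hm hA).le

namespace IsPeakedSubeigenvector

theorem mul_excess_nonneg (hx : IsPeakedSubeigenvector G r u x) (hr : 1 ≤ r) (v : V) :
    0 ≤ testVector G r u v * excess G r x v :=
  mul_nonneg (testVector_nonneg hr v) (hx.excess_nonneg v)

theorem excess_mul_nonneg (hx : IsPeakedSubeigenvector G r u x) (hG : ¬ HasChordedCycle G)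
    (hr : 1 ≤ r) (v : V) : 0 ≤ excess G r (testVector G r u) v * (1 - x v) := by
  obtain rfl | hv := eq_or_ne v u
  · rw [hx.apply_peak, sub_self, mul_zero]
  · exact mul_nonneg (excess_testVector_nonneg hG hr hv) (sub_nonneg.2 (hx.le_one v))

theorem sum_excess_testVector_nonneg (hx : IsPeakedSubeigenvector G r u x)
    (hG : ¬ HasChordedCycle G) (hr : 1 ≤ r) : 0 ≤ ∑ v, excess G r (testVector G r u) v := by
  rw [sum_excess_eq r x]
  exact add_nonneg (sum_nonneg fun v _ => hx.mul_excess_nonneg hr v)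
    (sum_nonneg fun v _ => hx.excess_mul_nonneg hG hr v)

variable (hx : IsPeakedSubeigenvector G r u x) (hG : ¬ HasChordedCycle G) (hr : 2 < r)
  (hm : #G.edgeFinset ≤ r ^ 2)
  (heq : (r - 1) * (r ^ 2 - #G.edgeFinset) = (3 - r) * (#(triangleNeighbors G u) / 2))
include hx hG hr hm heq

theorem attachedVertices_eq_empty : attachedVertices G u = ∅ := by
  by_contra hA
  have hsum := sum_excess_testVector_add (r := r) (u := u) hG
  linarith [hx.sum_excess_testVector_nonneg hG (by linarith),
    sum_degree_attachedVertices_lt hG hr hm (nonempty_iff_ne_empty.2 hA)]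

theorem sum_excess_testVector_eq_zero : ∑ v, excess G r (testVector G r u) v = 0 := by
  refine le_antisymm ?_ (hx.sum_excess_testVector_nonneg hG (by linarith))
  have hsum := sum_excess_testVector_add (r := r) (u := u) hG
  linarith [sum_degree_attachedVertices_le (u := u) hG hr hm]

theorem mul_excess_eq_zero_and_excess_mul_eq_zero (v : V) :
    testVector G r u v * excess G r x v = 0 ∧ excess G r (testVector G r u) v * (1 - x v) = 0 := by
  have hy := fun v (_ : v ∈ univ) => hx.mul_excess_nonneg (by linarith) v
  have hx' := fun v (_ : v ∈ univ) => hx.excess_mul_nonneg hG (by linarith) v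
  have hsum := hx.sum_excess_testVector_eq_zero hG hr hm heq
  rw [sum_excess_eq r x, add_eq_zero_iff_of_nonneg (sum_nonneg hy) (sum_nonneg hx'),
    sum_eq_zero_iff_of_nonneg hy, sum_eq_zero_iff_of_nonneg hx'] at hsum
  exact ⟨hsum.1 v (mem_univ v), hsum.2 v (mem_univ v)⟩

end IsPeakedSubeigenvector

end SpectralEstimate

section TightSpectralEstimate

variable {V : Type*} [Fintype V] {G : SimpleGraph V} [DecidableRel G.Adj] {r : ℝ} {u : V}
  {x : V → ℝ}

namespace IsPeakedSubeigenvector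

theorem sub_one_mul_sq_sub_card_edgeFinset_le (hx : IsPeakedSubeigenvector G r u x)
    (hG : ¬ HasChordedCycle G) (hr : 2 < r) (hm : #G.edgeFinset ≤ r ^ 2) :
    (r - 1) * (r ^ 2 - #G.edgeFinset) ≤ (3 - r) * (#(triangleNeighbors G u) / 2) := by
  classical
  rw [← sum_excess_testVector_add hG]
  linarith [hx.sum_excess_testVector_nonneg hG (by linarith),
    sum_degree_attachedVertices_le (u := u) hG hr hm]

variable (hx : IsPeakedSubeigenvector G r u x) (hG : ¬ HasChordedCycle G) (hr : 2 < r)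
  (hm : #G.edgeFinset ≤ r ^ 2)
  (heq : (r - 1) * (r ^ 2 - #G.edgeFinset) = (3 - r) * (#(triangleNeighbors G u) / 2))
include hx hG hr hm heq

theorem not_adj_of_compl_adj {v w : V} (hv : Gᶜ.Adj u v) (hw : Gᶜ.Adj u w) : ¬ G.Adj v w := by
  classical
  have hsum := sum_excess_testVector_add (r := r) (u := u) hG
  rw [hx.attachedVertices_eq_empty hG hr hm heq, card_empty, sum_empty, sub_zero, Nat.cast_zero,
    zero_add] at hsum
  have hzero : (∑ w ∈ Gᶜ.neighborFinset u, degreeIn G (Gᶜ.neighborFinset u) w : ℕ) = (0 : ℝ) := by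
    have := hx.sum_excess_testVector_nonneg hG (by linarith)
    refine le_antisymm ?_ (Nat.cast_nonneg _)
    nlinarith
  have := sum_eq_zero_iff.1 (Nat.cast_eq_zero.1 hzero) v ((mem_neighborFinset _ _ _).2 hv)
  exact degreeIn_eq_zero_iff.1 this w ((mem_neighborFinset _ _ _).2 hw)

theorem sum_neighborFinset_peak : ∑ a ∈ G.neighborFinset u, x a = r := by
  classical
  have hmul := (hx.mul_excess_eq_zero_and_excess_mul_eq_zero hG hr hm heq u).1
  rw [testVector_self, mul_eq_zero_iff_left (by nlinarith), excess, hx.apply_peak] at hmul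
  linarith

theorem pos_of_adj {a : V} (hua : G.Adj u a) : 0 < x a := by
  classical
  have hy : 0 < testVector G r u a := by
    rw [testVector_of_adj hua]
    split_ifs <;> linarith
  have hmul := (hx.mul_excess_eq_zero_and_excess_mul_eq_zero hG hr hm heq a).1
  rw [mul_eq_zero_iff_left hy.ne', excess, sub_eq_zero] at hmul
  have hle : x u ≤ ∑ w ∈ G.neighborFinset a, x w :=
    single_le_sum (fun w _ => hx.nonneg w) ((G.mem_neighborFinset a u).2 hua.symm)
  rw [hx.apply_peak, hmul] at hle
  exact pos_of_mul_pos_right (zero_lt_one.trans_le hle) (by linarith)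

theorem neighborFinset_subset_of_compl_adj {w : V} (hw : Gᶜ.Adj u w) :
    G.neighborFinset w ⊆ G.neighborFinset u := by
  intro a ha
  rw [mem_neighborFinset] at ha ⊢
  by_contra hua
  refine hx.not_adj_of_compl_adj hG hr hm heq hw ((G.compl_adj u a).2 ⟨?_, hua⟩) ha
  rintro rfl
  exact ((G.compl_adj u w).1 hw).2 ha.symm

theorem apply_eq_one_of_compl_adj {w : V} (hw : Gᶜ.Adj u w) (hiso : ¬ G.IsIsolated w) :
    x w = 1 := by
  classical
  have hpos : (0 : ℝ) < degreeIn G (G.neighborFinset u) w := by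
    obtain ⟨a, ha⟩ := exists_adj_iff_not_isIsolated.2 hiso
    have hua := hx.neighborFinset_subset_of_compl_adj hG hr hm heq hw
      ((G.mem_neighborFinset w a).2 ha)
    exact_mod_cast card_pos.2 ⟨a, mem_filter.2 ⟨hua, ha⟩⟩
  have hmul := (hx.mul_excess_eq_zero_and_excess_mul_eq_zero hG hr hm heq w).2
  rw [excess_testVector_of_compl_adj hG hw, hx.attachedVertices_eq_empty hG hr hm heq,
    if_neg (notMem_empty w), sub_zero,
    degreeIn_eq_zero_iff.2 (fun w hw => absurd hw (notMem_empty w)), Nat.cast_zero,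
    add_zero, mul_eq_zero_iff_left (by nlinarith)] at hmul
  linarith

theorem neighborFinset_eq_of_compl_adj {w : V} (hw : Gᶜ.Adj u w) (hiso : ¬ G.IsIsolated w) :
    G.neighborFinset w = G.neighborFinset u := by
  have hsub := hx.neighborFinset_subset_of_compl_adj hG hr hm heq hw
  by_contra hne
  obtain ⟨a, ha, haw⟩ := exists_of_ssubset (hsub.ssubset_of_ne hne)
  have hlt : ∑ a ∈ G.neighborFinset w, x a < ∑ a ∈ G.neighborFinset u, x a :=
    sum_lt_sum_of_subset hsub ha haw
      (hx.pos_of_adj hG hr hm heq ((G.mem_neighborFinset u a).1 ha)) fun v _ _ => hx.nonneg v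
  have hle := hx.excess_nonneg w
  rw [excess, hx.apply_eq_one_of_compl_adj hG hr hm heq hw hiso] at hle
  linarith [hx.sum_neighborFinset_peak hG hr hm heq]

end IsPeakedSubeigenvector

end TightSpectralEstimate

section MaxDegreeOne

variable {V : Type*} {H : SimpleGraph V}

theorem copies_two_adj {t : ℕ} {x y : Fin t × Fin 2} :
    (copies t (K 2)).Adj x y ↔ y = (x.1, x.2 + 1) := by
  obtain ⟨i, j⟩ := x
  obtain ⟨i', j'⟩ := y
  simp only [copies, top_adj, Prod.mk.injEq]
  fin_cases j <;> fin_cases j' <;> simp [eq_comm]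

theorem exists_embedding_copies_range_eq_support [Fintype H.edgeSet]
    (hH : ∀ a b c, H.Adj a b → H.Adj a c → b = c) :
    ∃ f : copies #H.edgeFinset (K 2) ↪g H, Set.range f = H.support := by
  let e : Fin #H.edgeFinset ≃ H.edgeSet := (Fintype.equivFinOfCardEq H.edgeFinset_card.symm).symm
  have hends : ∀ i, ∃ f : Fin 2 → V, (e i : Sym2 V) = s(f 0, f 1) := fun i => by
    induction h : (e i : Sym2 V) with | h p q =>
    exact ⟨![p, q], rfl⟩
  choose f hf using hends
  have hedge : ∀ i j, (e i : Sym2 V) = s(f i j, f i (j + 1)) := fun i j => by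
    fin_cases j
    · exact hf i
    · exact (hf i).trans Sym2.eq_swap
  have hadj : ∀ i j, H.Adj (f i j) (f i (j + 1)) := fun i j => by
    rw [← mem_edgeSet, ← hedge]
    exact (e i).2
  have hinj : ∀ i i' j j', f i j = f i' j' → i = i' ∧ j = j' := fun i i' j j' h => by
    have hnext : f i (j + 1) = f i' (j' + 1) := hH _ _ _ (hadj i j) (h ▸ hadj i' j')
    obtain rfl : i = i' := e.injective (Subtype.ext (by rw [hedge i j, hedge i' j', h, hnext]))
    refine ⟨rfl, ?_⟩
    by_contra hne
    obtain rfl : j' = j + 1 := by lia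
    exact (hadj i j).ne h
  refine ⟨⟨⟨fun x => f x.1 x.2, fun x y h => Prod.ext_iff.2 (hinj _ _ _ _ h)⟩, ?_⟩, ?_⟩
  · intro x y
    change H.Adj (f x.1 x.2) (f y.1 y.2) ↔ _
    rw [copies_two_adj]
    refine ⟨fun h => ?_, fun h => h ▸ hadj x.1 x.2⟩
    exact Prod.ext_iff.2 (hinj _ _ _ _ (hH _ _ _ h (hadj x.1 x.2)))
  · ext a
    refine ⟨?_, fun ⟨b, hab⟩ => ?_⟩
    · rintro ⟨x, rfl⟩
      exact ⟨_, hadj x.1 x.2⟩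
    · obtain ⟨i, hi⟩ := e.surjective ⟨s(a, b), hab⟩
      have hmem : a ∈ (e i : Sym2 V) := by simp [hi]
      rw [hf i, Sym2.mem_iff] at hmem
      obtain h | h := hmem
      exacts [⟨(i, 0), h.symm⟩, ⟨(i, 1), h.symm⟩]

theorem exists_iso_sum_copies_one [Finite V] {W : Type*} {F : SimpleGraph W} (f : F ↪g H)
    (hf : Set.range f = H.support) : ∃ s, Nonempty (H ≃g F ⊕g copies s (K 1)) := by
  classical
  obtain ⟨s, ⟨e⟩⟩ := Finite.exists_equiv_fin ↥(H.supportᶜ)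
  let φ : W ⊕ Fin s × Fin 1 ≃ V :=
    (((Equiv.ofInjective f f.injective).trans (Equiv.setCongr hf)).sumCongr
      ((Equiv.prodUnique (Fin s) (Fin 1)).trans e.symm)).trans (Equiv.Set.sumCompl H.support)
  have hinl : ∀ x, φ (Sum.inl x) = f x := fun _ => rfl
  have hisolated : ∀ p v, ¬ H.Adj (φ (Sum.inr p)) v := fun p v h =>
    (e.symm p.1).2 (H.mem_support.2 ⟨v, h⟩)
  refine ⟨s, ⟨RelIso.symm ⟨φ, ?_⟩⟩⟩
  rintro (x | p) (y | q)
  · simp [hinl]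
  · simpa using mt Adj.symm (hisolated q _)
  · simpa using hisolated p _
  · simpa [copies, Subsingleton.elim p.2 q.2] using hisolated p _

end MaxDegreeOne

section UniversalVertex

variable {V : Type*} {G : SimpleGraph V}

theorem nonempty_iso_join_of_universal {u : V} {W : Type*} {H : SimpleGraph W}
    (hu : ∀ v, v ≠ u → G.Adj u v) (e : G.induce (G.neighborSet u) ≃g H) :
    Nonempty (G ≃g join (K 1) H) := by
  classical
  have hcompl : G.neighborSet u = ({u} : Set V)ᶜ := by
    ext v
    exact ⟨fun h => h.ne', hu v⟩
  let φ : Fin 1 ⊕ W ≃ V :=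
    ((Equiv.ofUnique (Fin 1) ({u} : Set V)).sumCongr
      (e.symm.toEquiv.trans (Equiv.setCongr hcompl))).trans (Equiv.Set.sumCompl {u})
  have hinl : ∀ z, φ (Sum.inl z) = u := fun _ => rfl
  have hinr : ∀ x, φ (Sum.inr x) = e.symm x := fun _ => rfl
  have hadj : ∀ x, G.Adj u (e.symm x) := fun x => (e.symm x).2
  refine ⟨RelIso.symm ⟨φ, ?_⟩⟩
  rintro (z | x) (z' | y)
  · simp [hinl, join, Subsingleton.elim z z']
  · simp [hinl, hinr, join, hadj]
  · simp [hinl, hinr, join, (hadj _).symm]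
  · simpa [hinr, join] using e.symm.map_adj_iff (v := x) (w := y)

end UniversalVertex

section Bipartite

variable {V : Type*} {G : SimpleGraph V}

theorem nonempty_iso_completeBipartiteGraph [Fintype V] [DecidableEq V] {S : Finset V}
    (h : ∀ v w, G.Adj v w ↔ (v ∈ S ↔ w ∉ S)) :
    Nonempty (G ≃g completeBipartiteGraph (Fin #S) (Fin #Sᶜ)) := by
  let φ : Fin #S ⊕ Fin #Sᶜ ≃ V :=
    (S.equivFin.symm.sumCongr (Sᶜ.equivFin.symm.trans
      (Equiv.subtypeEquivRight fun _ => mem_compl))).trans (Equiv.sumCompl (· ∈ S))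
  have hinl : ∀ x, φ (Sum.inl x) ∈ S := fun x => (S.equivFin.symm x).2
  have hinr : ∀ x, φ (Sum.inr x) ∉ S := fun x => mem_compl.1 (Sᶜ.equivFin.symm x).2
  refine ⟨RelIso.symm ⟨φ, ?_⟩⟩
  rintro (x | x) (y | y) <;> simp [h, hinl, hinr]

theorem exists_iso_completeBipartiteGraph [Finite V] (hG : ¬ HasChordedCycle G) {S : Finset V}
    (h : ∀ v w, G.Adj v w ↔ (v ∈ S ↔ w ∉ S)) :
    ∃ a b, a ≤ 2 ∧ Nonempty (G ≃g completeBipartiteGraph (Fin a) (Fin b)) := by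
  classical
  have := Fintype.ofFinite V
  obtain hS | hS := card_le_two_or_card_le_two hG (S := S) (R := Sᶜ) fun v hv w hw =>
    (h v w).2 (iff_of_true hv (mem_compl.1 hw))
  · exact ⟨_, _, hS, nonempty_iso_completeBipartiteGraph h⟩
  · refine ⟨_, _, hS, nonempty_iso_completeBipartiteGraph fun v w => ?_⟩
    rw [h, mem_compl, mem_compl]
    tauto

end Bipartite

section CardEdgeFinset

variable {V : Type*} {G : SimpleGraph V}

theorem card_edgeFinset_of_iso_completeBipartiteGraph [Fintype G.edgeSet] {a b : ℕ}
    (e : G ≃g completeBipartiteGraph (Fin a) (Fin b)) : #G.edgeFinset = a * b := by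
  classical
  have h := encard_edgeSet_completeBipartiteGraph (W₁ := Fin a) (W₂ := Fin b)
  rw [e.card_edgeFinset_eq, ← ENat.natCast_inj, ← Set.encard_coe_eq_coe_finsetCard,
    coe_edgeFinset, h]
  simp

variable [Fintype V] [DecidableRel G.Adj]

theorem card_triangleNeighbors (hG : ¬ HasChordedCycle G) (u : V) :
    #(triangleNeighbors G u) = 2 * #(G.induce (G.neighborSet u)).edgeFinset := by
  classical
  have hdeg : ∀ a, (G.induce (G.neighborSet u)).degree a = degreeIn G (G.neighborFinset u) a :=
    fun a => by
      rw [← card_neighborFinset_eq_degree, ← card_map, map_neighborFinset_induce, degreeIn]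
      congr 1
      ext b
      simp [and_comm]
  rw [← sum_degreeIn_neighborFinset hG, ← sum_degrees_eq_twice_card_edges,
    sum_subtype (G.neighborFinset u) (G.mem_neighborFinset u)]
  exact (sum_congr rfl fun a _ => hdeg a).symm

theorem three_mul_card_edgeFinset_induce_le (hG : ¬ HasChordedCycle G) (u : V) :
    3 * #(G.induce (G.neighborSet u)).edgeFinset ≤ #G.edgeFinset := by
  classical
  have hcard := card_triangleNeighbors hG u
  have hle := card_le_card (triangleNeighbors_subset (G := G) (u := u))
  rw [card_neighborFinset_eq_degree] at hle
  have hsize := two_mul_card_edgeFinset (G := G) u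
  rw [sum_degreeIn_neighborFinset hG] at hsize
  lia

theorem nonempty_iso_triangleStar (hG : ¬ HasChordedCycle G) {u : V}
    (hu : ∀ v, v ≠ u → G.Adj u v) :
    Nonempty (G ≃g triangleStar #(G.induce (G.neighborSet u)).edgeFinset
      (#G.edgeFinset - 3 * #(G.induce (G.neighborSet u)).edgeFinset)) := by
  classical
  obtain ⟨f, hf⟩ := exists_embedding_copies_range_eq_support (H := G.induce (G.neighborSet u))
    fun a b c hab hac => Subtype.ext (eq_of_adj_of_adj_of_adj hG a.2 b.2 c.2 hab hac)
  obtain ⟨s, ⟨e⟩⟩ := exists_iso_sum_copies_one f hf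
  have hdeg : G.degree u = #(G.induce (G.neighborSet u)).edgeFinset * 2 + s := by
    have := Fintype.card_congr e.toEquiv
    rw [card_neighborSet_eq_degree] at this
    simpa using this
  have hfar : Gᶜ.neighborFinset u = ∅ := eq_empty_of_forall_notMem fun v hv => by
    rw [mem_neighborFinset, compl_adj] at hv
    exact hv.2 (hu v hv.1.symm)
  have hsize := two_mul_card_edgeFinset (G := G) u
  rw [hfar, sum_degreeIn_neighborFinset hG, card_triangleNeighbors hG] at hsize
  simp only [sum_empty] at hsize
  obtain rfl : s = #G.edgeFinset - 3 * #(G.induce (G.neighborSet u)).edgeFinset := by lia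
  exact nonempty_iso_join_of_universal hu e

end CardEdgeFinset

section Tight

variable {V : Type*} [Fintype V] {G : SimpleGraph V} [DecidableRel G.Adj]
  {r : ℝ} {u : V} {x : V → ℝ}

namespace IsPeakedSubeigenvector

variable (hx : IsPeakedSubeigenvector G r u x) (hG : ¬ HasChordedCycle G) (hr : 2 < r)
  (hm : #G.edgeFinset ≤ r ^ 2)
  (heq : (r - 1) * (r ^ 2 - #G.edgeFinset) = (3 - r) * (#(triangleNeighbors G u) / 2))
  (hiso : ∀ v, ¬ G.IsIsolated v)
include hx hG hr hm heq hiso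

theorem adj_of_triangleNeighbors_nonempty (hT : (triangleNeighbors G u).Nonempty) (v : V)
    (hv : v ≠ u) : G.Adj u v := by
  classical
  by_contra huv
  have hcompl : Gᶜ.Adj u v := (G.compl_adj u v).2 ⟨hv.symm, huv⟩
  obtain ⟨a, ha⟩ := hT
  have hva : G.Adj v a := by
    rw [← mem_neighborFinset, hx.neighborFinset_eq_of_compl_adj hG hr hm heq hcompl (hiso v)]
    exact triangleNeighbors_subset ha
  have hattached := mem_attachedVertices.2 ⟨hcompl, a, ha, hva⟩
  rw [hx.attachedVertices_eq_empty hG hr hm heq] at hattached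
  exact notMem_empty v hattached

theorem adj_iff_of_triangleNeighbors_eq_empty (hT : triangleNeighbors G u = ∅) (v w : V) :
    G.Adj v w ↔ (v ∈ G.neighborFinset u ↔ w ∉ G.neighborFinset u) := by
  have hfar : ∀ v, v ∉ G.neighborFinset u → G.neighborFinset v = G.neighborFinset u := by
    intro v hv
    obtain rfl | hvu := eq_or_ne v u
    · rfl
    · exact hx.neighborFinset_eq_of_compl_adj hG hr hm heq
        ((G.compl_adj u v).2 ⟨hvu.symm, mt (G.mem_neighborFinset u v).2 hv⟩) (hiso v)
  by_cases hv : v ∈ G.neighborFinset u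
  · by_cases hw : w ∈ G.neighborFinset u
    · have hvT : v ∉ triangleNeighbors G u := hT ▸ notMem_empty v
      rw [mem_neighborFinset] at hv hw
      simpa [hv, hw] using fun h => hvT (mem_triangleNeighbors.2 ⟨hv, w, hw, h⟩)
    · rw [G.adj_comm, ← mem_neighborFinset, hfar w hw]
      tauto
  · rw [← mem_neighborFinset, hfar v hv]
    tauto

end IsPeakedSubeigenvector

theorem exists_sub_one_mul_sq_sub_card_edgeFinset_le [DecidableEq V] (hG : ¬ HasChordedCycle G)
    (hiso : ∀ v, ¬ G.IsIsolated v) (hr : 2 < r) (hm : #G.edgeFinset ≤ r ^ 2)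
    (h : Module.End.HasEigenvalue (Matrix.toLin' (G.adjMatrix ℝ)) r) :
    ∃ t : ℕ, 3 * t ≤ #G.edgeFinset ∧ (r - 1) * (r ^ 2 - #G.edgeFinset) ≤ (3 - r) * t ∧
      ((r - 1) * (r ^ 2 - #G.edgeFinset) = (3 - r) * t →
        (0 < t ∧ Nonempty (G ≃g triangleStar t (#G.edgeFinset - 3 * t))) ∨
        (t = 0 ∧ ∃ a b, a ≤ 2 ∧ Nonempty (G ≃g completeBipartiteGraph (Fin a) (Fin b)))) := by
  obtain ⟨u, x, hx⟩ := exists_isPeakedSubeigenvector (by linarith) h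
  have hle := hx.sub_one_mul_sq_sub_card_edgeFinset_le hG hr hm
  have heq := hx.adj_of_triangleNeighbors_nonempty hG hr hm
  have hbip := hx.adj_iff_of_triangleNeighbors_eq_empty hG hr hm
  have hcard := card_triangleNeighbors hG u
  have hcast : (#(triangleNeighbors G u) : ℝ) / 2 = #(G.induce (G.neighborSet u)).edgeFinset := by
    rw [hcard]
    push_cast
    ring
  rw [hcast] at hle heq hbip
  refine ⟨_, three_mul_card_edgeFinset_induce_le hG u, hle, fun htight => ?_⟩
  obtain hT | hT := (triangleNeighbors G u).eq_empty_or_nonempty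
  · refine Or.inr ⟨?_, exists_iso_completeBipartiteGraph hG (hbip htight hiso hT)⟩
    rw [hT, card_empty] at hcard
    lia
  · refine Or.inl ⟨?_, nonempty_iso_triangleStar hG (heq htight hiso hT)⟩
    have := hT.card_pos
    lia

end Tight

section RhoLowerBounds

variable {V W : Type*} [Fintype V] [DecidableEq V] [Fintype W] [DecidableEq W]
  {G : SimpleGraph V} [DecidableRel G.Adj] {H : SimpleGraph W} [DecidableRel H.Adj] {r : ℝ}

theorem nonempty_of_hasEigenvalue_adjMatrix
    (h : Module.End.HasEigenvalue (Matrix.toLin' (G.adjMatrix ℝ)) r) : Nonempty V := by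
  obtain ⟨y, hy, -⟩ := hasEigenvalue_adjMatrix_iff.1 h
  exact (Function.ne_iff.1 hy).nonempty

theorem hasEigenvalue_adjMatrix_of_iso (e : G ≃g H)
    (h : Module.End.HasEigenvalue (Matrix.toLin' (H.adjMatrix ℝ)) r) :
    Module.End.HasEigenvalue (Matrix.toLin' (G.adjMatrix ℝ)) r := by
  obtain ⟨y, hy, hyr⟩ := hasEigenvalue_adjMatrix_iff.1 h
  refine hasEigenvalue_adjMatrix_iff.2 ⟨y ∘ e, ?_, fun v => ?_⟩
  · rwa [Ne, ← e.surjective.injective_comp_right.eq_iff] at hy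
  · rw [Function.comp_apply, ← hyr]
    exact sum_equiv e.toEquiv (fun w => by simp [e.map_adj_iff]) fun w _ => rfl

theorem le_rho_of_iso (e : G ≃g H)
    (h : Module.End.HasEigenvalue (Matrix.toLin' (H.adjMatrix ℝ)) r) : r ≤ rho G :=
  have hG := hasEigenvalue_adjMatrix_of_iso e h
  have := nonempty_of_hasEigenvalue_adjMatrix hG
  (isGreatest_rho G).2 hG

theorem hasEigenvalue_adjMatrix_triangleStar {t s : ℕ} [DecidableRel (triangleStar t s).Adj]
    (hr : 1 < r) (h : (r - 1) * (r ^ 2 - (3 * t + s)) = (3 - r) * t) :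
    Module.End.HasEigenvalue (Matrix.toLin' ((triangleStar t s).adjMatrix ℝ)) r := by
  refine hasEigenvalue_adjMatrix_iff.2 ⟨Sum.elim (fun _ => r * (r - 1))
    (Sum.elim (fun _ => r) (fun _ => r - 1)), fun h0 => ?_, ?_⟩
  · have : r * (r - 1) = 0 := congrFun h0 (Sum.inl 0)
    nlinarith
  · simp only [neighborFinset_eq_filter, sum_filter, Fintype.sum_sum_type, Sum.elim_inl,
      Sum.elim_inr]
    rintro (x | ⟨i, j⟩ | x)
    · rw [Subsingleton.elim x 0]
      simp [triangleStar_adj_inl]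
      linarith
    · simp [triangleStar_adj_pair]
      ring
    · simp [triangleStar_adj_leaf]

theorem hasEigenvalue_adjMatrix_completeBipartiteGraph {a b : ℕ}
    [DecidableRel (completeBipartiteGraph (Fin a) (Fin b)).Adj] (ha : 0 < a) (hb : 0 < b) :
    Module.End.HasEigenvalue
      (Matrix.toLin' ((completeBipartiteGraph (Fin a) (Fin b)).adjMatrix ℝ)) √(a * b) := by
  refine hasEigenvalue_adjMatrix_iff.2 ⟨Sum.elim (fun _ => √(a * b)) (fun _ => a), fun h0 => ?_, ?_⟩
  · have : (a : ℝ) = 0 := congrFun h0 (Sum.inr ⟨0, hb⟩)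
    exact ha.ne' (by exact_mod_cast this)
  · have hsq : √((a : ℝ) * b) * √(a * b) = a * b := Real.mul_self_sqrt (by positivity)
    simp only [neighborFinset_eq_filter, sum_filter, Fintype.sum_sum_type, Sum.elim_inl,
      Sum.elim_inr]
    rintro (x | x)
    · simp only [Sum.elim_inl, hsq]
      simp [mul_comm]
    · simp [mul_comm]

end RhoLowerBounds

section Theta

variable {m : ℕ} {x : ℝ}

theorem theta_sub_one_mul_sq_sub (m : ℕ) :
    (theta m - 1) * (theta m ^ 2 - m) = (3 - theta m) * (m / 3 : ℕ) := by
  have hroot : theta m ^ 3 - theta m ^ 2 + (((m / 3 : ℕ) : ℝ) - m) * theta m + m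
      - 3 * ((m / 3 : ℕ) : ℝ) = 0 := (isGreatest_theta m).1
  linear_combination hroot

theorem le_theta_of_sub_one_mul_sq_sub_le
    (h : (x - 1) * (x ^ 2 - m) ≤ (3 - x) * (m / 3 : ℕ)) : x ≤ theta m := by
  have hcont : Continuous fun y : ℝ => (y - 1) * (y ^ 2 - m) - (3 - y) * (m / 3 : ℕ) := by fun_prop
  have hlarge : 0 ≤ (max x (m + 3) - 1) * (max x (m + 3) ^ 2 - m)
      - (3 - max x (m + 3)) * (m / 3 : ℕ) := by
    have hm : (0 : ℝ) ≤ m := m.cast_nonneg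
    have hy : (m : ℝ) + 3 ≤ max x (m + 3) := le_max_right ..
    have hsq : (m : ℝ) ≤ max x (m + 3) ^ 2 := by nlinarith only [hm, hy]
    have hpos := mul_nonneg (by linarith : 0 ≤ max x (m + 3) - 1) (sub_nonneg.2 hsq)
    have hneg := mul_nonneg (by linarith : 0 ≤ max x (m + 3) - 3) (m / 3).cast_nonneg
    linarith
  obtain ⟨y, ⟨hxy, -⟩, hy⟩ := intermediate_value_Icc (le_max_left x (m + 3)) hcont.continuousOn
    ⟨sub_nonpos.2 h, hlarge⟩
  refine hxy.trans ((isGreatest_theta m).2 ?_)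
  rw [Set.mem_ofPred_eq]
  linear_combination hy

theorem le_sub_one_mul_sq_sub_of_theta_le (h : theta m ≤ x) :
    (3 - x) * (m / 3 : ℕ) ≤ (x - 1) * (x ^ 2 - m) := by
  by_contra! hlt
  obtain rfl := h.antisymm (le_theta_of_sub_one_mul_sq_sub_le hlt.le)
  exact hlt.ne (theta_sub_one_mul_sq_sub m)

theorem sqrt_lt_theta (hm : 3 ≤ m) (hm' : m < 9) : √m < theta m := by
  have hsq : √(m : ℝ) ^ 2 = m := Real.sq_sqrt m.cast_nonneg
  have hlt : √(m : ℝ) < 3 := by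
    rw [Real.sqrt_lt' three_pos]
    norm_cast
  have ht : (0 : ℝ) < (m / 3 : ℕ) := Nat.cast_pos.2 (by lia)
  have hpos : 0 < (3 - √(m : ℝ)) * (m / 3 : ℕ) := mul_pos (sub_pos.2 hlt) ht
  refine (le_theta_of_sub_one_mul_sq_sub_le ?_).lt_of_ne fun h => ?_
  · rw [hsq, sub_self, mul_zero]
    exact hpos.le
  · rw [h, ← theta_sub_one_mul_sq_sub m, ← h, hsq, sub_self, mul_zero] at hpos
    exact hpos.false

end Theta

section IsExtremalLarge

variable {V : Type*} {G : SimpleGraph V}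

theorem isExtremalLarge_of_iso_triangleStar {t : ℕ} (ht : 0 < t) (ht3 : t ≤ 3)
    (e : G ≃g triangleStar t (9 - 3 * t)) : IsExtremalLarge 9 G := by
  refine Or.inl ⟨rfl, ?_⟩
  interval_cases t
  · exact Or.inr (Or.inr (Or.inl ⟨e⟩))
  · exact Or.inr (Or.inl ⟨e⟩)
  · exact Or.inl ⟨e⟩

theorem isExtremalLarge_of_iso_completeBipartiteGraph {a b : ℕ} (ha : a ≤ 2) (hm : 9 ≤ a * b)
    (e : G ≃g completeBipartiteGraph (Fin a) (Fin b)) : IsExtremalLarge (a * b) G := by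
  interval_cases a
  · lia
  · rw [one_mul] at hm ⊢
    obtain rfl | hm10 := hm.eq_or_lt
    · exact Or.inl ⟨rfl, Or.inr (Or.inr (Or.inr ⟨e⟩))⟩
    · exact Or.inr ⟨hm10, Or.inl ⟨e⟩⟩
  · refine Or.inr ⟨by lia, Or.inr ⟨even_two_mul b, ?_⟩⟩
    rw [Nat.mul_div_cancel_left b two_pos]
    exact ⟨e⟩

end IsExtremalLarge

section Extremal

variable {V : Type*} [Fintype V] [DecidableEq V] {G : SimpleGraph V} [DecidableRel G.Adj] {m : ℕ}

theorem hasEigenvalue_rho_of_pos (h : 0 < rho G) :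
    Module.End.HasEigenvalue (Matrix.toLin' (G.adjMatrix ℝ)) (rho G) := by
  obtain ⟨r, hr⟩ : {x | Module.End.HasEigenvalue (Matrix.toLin' (G.adjMatrix ℝ)) x}.Nonempty := by
    by_contra! hempty
    rw [rho, hempty, Real.sSup_empty] at h
    exact h.false
  have := nonempty_of_hasEigenvalue_adjMatrix hr
  exact (isGreatest_rho G).1

theorem isExtremalSmall_of_theta_le_rho (hG : ¬ HasChordedCycle G)
    (hiso : ∀ v, ¬ G.IsIsolated v) (hsize : #G.edgeFinset = m) (hm : 4 ≤ m) (hm8 : m ≤ 8)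
    (h : theta m ≤ rho G) : IsExtremalSmall m G ∧ rho G = theta m := by
  have hr : √m < rho G := (sqrt_lt_theta (by lia) (by lia)).trans_le h
  have hr2 : 2 < rho G := (Real.le_sqrt' two_pos).2 (by norm_num; exact_mod_cast hm) |>.trans_lt hr
  have hsq : (m : ℝ) < rho G ^ 2 := (Real.sqrt_lt' (by linarith)).1 hr
  obtain ⟨t, htm, hle, heq⟩ := exists_sub_one_mul_sq_sub_card_edgeFinset_le hG hiso hr2
    (hsize ▸ hsq.le) (hasEigenvalue_rho_of_pos (by linarith))
  rw [hsize] at htm hle heq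
  have hpos : 0 < (3 - rho G) * t :=
    (mul_pos (by linarith) (sub_pos.2 hsq)).trans_le hle
  have hr3 : 0 < 3 - rho G := pos_of_mul_pos_left hpos t.cast_nonneg
  have hmt : ((m / 3 : ℕ) : ℝ) ≤ t :=
    le_of_mul_le_mul_left ((le_sub_one_mul_sq_sub_of_theta_le h).trans hle) hr3
  obtain rfl : t = m / 3 := le_antisymm (by lia) (by exact_mod_cast hmt)
  have htight := hle.antisymm (le_sub_one_mul_sq_sub_of_theta_le h)
  refine ⟨?_, (le_theta_of_sub_one_mul_sq_sub_le hle).antisymm h⟩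
  exact (heq htight).elim (fun h => h.2) fun h => absurd h.1 (by lia)

theorem isExtremalLarge_of_sqrt_le_rho (hG : ¬ HasChordedCycle G)
    (hiso : ∀ v, ¬ G.IsIsolated v) (hsize : #G.edgeFinset = m) (hm : 9 ≤ m)
    (h : √m ≤ rho G) : IsExtremalLarge m G ∧ rho G = √m := by
  have hr3 : 3 ≤ rho G := (Real.le_sqrt' three_pos).2 (by norm_num; exact_mod_cast hm) |>.trans h
  have hsq : (m : ℝ) ≤ rho G ^ 2 := (Real.sqrt_le_left (by linarith)).1 h
  obtain ⟨t, htm, hle, heq⟩ := exists_sub_one_mul_sq_sub_card_edgeFinset_le hG hiso (by linarith)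
    (hsize ▸ hsq) (hasEigenvalue_rho_of_pos (by linarith))
  rw [hsize] at htm hle heq
  have hnonneg : 0 ≤ (rho G - 1) * (rho G ^ 2 - m) := mul_nonneg (by linarith) (sub_nonneg.2 hsq)
  have hnonpos : (3 - rho G) * t ≤ 0 :=
    mul_nonpos_of_nonpos_of_nonneg (by linarith) t.cast_nonneg
  have hsq_eq : rho G ^ 2 = m := by nlinarith
  refine ⟨?_, by rw [← hsq_eq, Real.sqrt_sq (by linarith)]⟩
  obtain ⟨ht, ⟨e⟩⟩ | ⟨-, a, b, ha, ⟨e⟩⟩ := heq (by linarith)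
  · have hr : rho G = 3 := by
      have : (0 : ℝ) < t := Nat.cast_pos.2 ht
      nlinarith
    obtain rfl : m = 9 := by
      rw [hr] at hsq_eq
      exact_mod_cast (by linarith : (m : ℝ) = 9)
    exact isExtremalLarge_of_iso_triangleStar ht (by lia) e
  · obtain rfl : a * b = m := by rw [← hsize, card_edgeFinset_of_iso_completeBipartiteGraph e]
    exact isExtremalLarge_of_iso_completeBipartiteGraph ha hm e

theorem IsExtremalSmall.theta_le_rho (hm : 3 ≤ m) (hm8 : m ≤ 8) (h : IsExtremalSmall m G) :
    theta m ≤ rho G := by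
  classical
  obtain ⟨e⟩ := h
  have hone : 1 ≤ √(m : ℝ) := Real.one_le_sqrt.2 (by exact_mod_cast (by lia : 1 ≤ m))
  refine le_rho_of_iso e (hasEigenvalue_adjMatrix_triangleStar
    (hone.trans_lt (sqrt_lt_theta hm (by lia))) ?_)
  rw [← theta_sub_one_mul_sq_sub, Nat.cast_sub (Nat.mul_div_le m 3)]
  push_cast
  ring

theorem IsExtremalLarge.sqrt_le_rho (h : IsExtremalLarge m G) : √m ≤ rho G := by
  classical
  have hnine : √((9 : ℕ) : ℝ) = 3 := by
    rw [Nat.cast_ofNat, Real.sqrt_eq_iff_mul_self_eq] <;> norm_num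
  have hbip {a b : ℕ} (ha : 0 < a) (hb : 0 < b)
      (e : G ≃g completeBipartiteGraph (Fin a) (Fin b)) : √((a * b : ℕ) : ℝ) ≤ rho G := by
    rw [Nat.cast_mul]
    exact le_rho_of_iso e (hasEigenvalue_adjMatrix_completeBipartiteGraph ha hb)
  have hstar {t s : ℕ} (e : G ≃g triangleStar t s) (hts : 3 * t + s = 9) :
      √((9 : ℕ) : ℝ) ≤ rho G := by
    rw [hnine]
    refine le_rho_of_iso e (hasEigenvalue_adjMatrix_triangleStar (by norm_num) ?_)
    have : (3 * t + s : ℝ) = 9 := by exact_mod_cast hts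
    rw [this]
    norm_num
  rcases h with ⟨rfl, ⟨⟨e⟩⟩ | ⟨⟨e⟩⟩ | ⟨⟨e⟩⟩ | ⟨⟨e⟩⟩⟩ | ⟨hm, ⟨⟨e⟩⟩ | ⟨hev, ⟨e⟩⟩⟩
  · exact hstar e rfl
  · exact hstar e rfl
  · exact hstar e rfl
  · exact hbip one_pos (by lia) e
  · simpa only [one_mul] using hbip one_pos (by lia) e
  · simpa only [Nat.mul_div_cancel' hev.two_dvd] using hbip two_pos (by lia) e

end Extremal

end ChordedCycle

theorem mainTheorem1 {V : Type*} [Fintype V] [DecidableEq V] (G : SimpleGraph V)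
    [DecidableRel G.Adj] (m : ℕ) (hiso : ∀ v : V, ¬ G.IsIsolated v)
    (hsize : G.edgeFinset.card = m) (hm : 4 ≤ m) :
    (m ≤ 8 →
      (ChordedCycle.theta m ≤ ChordedCycle.rho G →
        ChordedCycle.HasChordedCycle G ∨ ChordedCycle.IsExtremalSmall m G) ∧
      (¬ ChordedCycle.HasChordedCycle G →
        ChordedCycle.rho G ≤ ChordedCycle.theta m ∧
        (ChordedCycle.rho G = ChordedCycle.theta m ↔ ChordedCycle.IsExtremalSmall m G)) ∧
      (ChordedCycle.IsExtremalSmall m G → ¬ ChordedCycle.HasChordedCycle G)) ∧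
    (9 ≤ m →
      (Real.sqrt m ≤ ChordedCycle.rho G →
        ChordedCycle.HasChordedCycle G ∨ ChordedCycle.IsExtremalLarge m G) ∧
      (¬ ChordedCycle.HasChordedCycle G →
        ChordedCycle.rho G ≤ Real.sqrt m ∧
        (ChordedCycle.rho G = Real.sqrt m ↔ ChordedCycle.IsExtremalLarge m G)) ∧
      (ChordedCycle.IsExtremalLarge m G → ¬ ChordedCycle.HasChordedCycle G)) := by
  refine ⟨fun hm8 => ?_, fun hm9 => ?_⟩
  · have hextremal := fun hG => ChordedCycle.isExtremalSmall_of_theta_le_rho (G := G) hG hiso hsize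
      hm hm8
    have hle := ChordedCycle.IsExtremalSmall.theta_le_rho (G := G) (by lia : 3 ≤ m) hm8
    exact ⟨fun h => or_iff_not_imp_left.2 fun hG => (hextremal hG h).1,
      fun hG => ⟨le_of_not_gt fun h => h.ne' (hextremal hG h.le).2,
        fun h => (hextremal hG h.ge).1, fun h => (hextremal hG (hle h)).2⟩,
      ChordedCycle.IsExtremalSmall.not_hasChordedCycle⟩
  · have hextremal := fun hG => ChordedCycle.isExtremalLarge_of_sqrt_le_rho (G := G) hG hiso hsize
      hm9
    have hle := ChordedCycle.IsExtremalLarge.sqrt_le_rho (G := G) (m := m)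
    exact ⟨fun h => or_iff_not_imp_left.2 fun hG => (hextremal hG h).1,
      fun hG => ⟨le_of_not_gt fun h => h.ne' (hextremal hG h.le).2,
        fun h => (hextremal hG h.ge).1, fun h => (hextremal hG (hle h)).2⟩,
      ChordedCycle.IsExtremalLarge.not_hasChordedCycle⟩
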